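/- Let $G$ be a group. For a matrix $A \in M_{r,s}(\mathbb{Z}G)$ with $r,s \ge 1$ let $r_A^{(2)} \colon L^2(G)^r \to L^2(G)^s$, $(x_k)_k \mapsto \bigl(\sum_{k} x_k a_{k,j}\bigr)_j$, be the bounded $G$-equivariant operator given by right multiplication with $A$. For a bounded $G$-equivariant operator $f \colon L^2(G)^r \to L^2(G)^s$ let $F_f(\lambda) = \dim_{\mathcal{N}(G)}\bigl(\operatorname{im} E^{f^*f}_{\lambda^2}\bigr)$ for $\lambda \ge 0$ (and $F_f(\lambda) = 0$ for $\lambda<0$) be its spectral density function, where $\{E^{f^*f}_{\mu}\}_{\mu\in\mathbb{R}}$ is the right-continuous family of spectral projections of $f^*f$ and $\dim_{\mathcal{N}(G)}(\operatorname{im} E) = \sum_{i=1}^r \langle E(e_i), e_i\rangle$ with $e_i \in L^2(G)^r$ the vector whose $i$-th entry is the unit element of $G$ and whose other entries are $0$. The Fuglede-Kadison determinant of $f$ is $\det_{\mathcal{N}(G)}(f) = \exp\bigl(\int_{0+}^\infty \ln(\lambda)\, dF_f\bigr)$ if the integral converges to a real number, and $0$ otherwise. Define $\Lambda(G)$ to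 be the infimum of the numbers $\det_{\mathcal{N}(G)}(r_A^{(2)})$, where $A$ runs through all $(r,s)$-matrices over $\mathbb{Z}G$, for all $r,s\ge 1$, with $\det_{\mathcal{N}(G)}(r_A^{(2)}) > 1$. Define $\Lambda_1(G)$ in the same way using only $(1,1)$-matrices, $\Lambda^w(G)$ using only square matrices $A$ for which $r_A^{(2)}$ is a weak isomorphism (injective with dense image), and $\Lambda_1^w(G)$ using only $(1,1)$-matrices $A$ for which $r_A^{(2)}$ is a weak isomorphism. Let $L = \mathbb{Z}/2 \wr \mathbb{Z} = \bigl(\bigoplus_{\mathbb{Z}} \mathbb{Z}/2\bigr) \rtimes \mathbb{Z}$ be the lamplighter group. Then $L$ is finitely generated, it contains finite subgroups of arbitrarily large order, and \[ \Lambda(L) = \Lambda^w(L) = \Lambda_1(L) = \Lambda_1^w(L) = 1. \] Moreover, $L$ is isomorphic to a subgroup of a finitely presented group $G$ with \[ \Lambda(G) = \Lambda^w(G) = \Lambda_1(G) = \Lambda_1^w(G) = 1. \] In particular, there exists a finitely presented group all four of whose constants are equal to $1$. -/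

import Mathlib

open MeasureTheory

noncomputable section

namespace Lehmer

/-! ### The lamplighter group -/

/-- The shift action of `ℤ` on the finitely supported functions `ℤ → ℤ/2`:
`n` sends `u` to `k ↦ u (k - n)`. -/
def lampShift :
    Multiplicative ℤ →* MulAut (Multiplicative (ℤ →₀ ZMod 2)) where
  toFun n := AddEquiv.toMultiplicative (Finsupp.domCongr (Equiv.addRight n.toAdd))
  map_one' := by
    ext u k
    change u.toAdd (k + -0) = u.toAdd k
    simp
  map_mul' m n := by
    ext u k
    change u.toAdd (k + -(m.toAdd + n.toAdd)) = u.toAdd (k + -m.toAdd + -n.toAdd)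
    congr 1
    ring

/-- The lamplighter group `ℤ/2 ≀ ℤ`, the restricted wreath product
`(⨁_ℤ ℤ/2) ⋊ ℤ` with respect to the shift. -/
abbrev Lamplighter : Type :=
  Multiplicative (ℤ →₀ ZMod 2) ⋊[lampShift] Multiplicative ℤ

/-! ### The Hilbert spaces `L²(G)^r` and right multiplication by matrices -/

section Operators

variable (G : Type*)

/-- The Hilbert space `L²(G)` of square summable functions `G → ℂ`. -/
abbrev L2 : Type _ := lp (fun _ : G => ℂ) 2

/-- The Hilbert space `L²(G)^r`, the orthogonal direct sum of `r` copies of `L²(G)`. -/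
abbrev L2Pow (r : ℕ) : Type _ := PiLp 2 (fun _ : Fin r => L2 G)

variable {G} [Group G]

/-- Right translation `x ↦ x · h` on `L²(G)`. It sends the basis element `g` to `g * h`,
that is, `(x · h)(g) = x (g * h⁻¹)`. -/
def rightTranslation (h : G) : L2 G →ₗᵢ[ℂ] L2 G where
  toFun x := ⟨fun g => x (g * h⁻¹), by
    refine (memℓp_gen_iff (by norm_num)).mpr ?_
    exact (Equiv.mulRight h⁻¹).summable_iff.mpr
      ((memℓp_gen_iff (by norm_num)).mp (lp.memℓp x))⟩
  map_add' x y := by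
    ext g
    rfl
  map_smul' c x := by
    ext g
    rfl
  norm_map' x := by
    rw [lp.norm_eq_tsum_rpow (by norm_num), lp.norm_eq_tsum_rpow (by norm_num)]
    congr 1
    exact (Equiv.mulRight h⁻¹).tsum_eq (fun g => ‖x g‖ ^ (2 : ENNReal).toReal)

/-- Right multiplication `x ↦ x · a` on `L²(G)` by an element `a` of the integral group ring. -/
def rightMul (a : MonoidAlgebra ℤ G) : L2 G →L[ℂ] L2 G :=
  ∑ h ∈ a.coeff.support, (a.coeff h : ℂ) • (rightTranslation h).toContinuousLinearMap

/-- The bounded operator `r_A^{(2)} : L²(G)^r → L²(G)^s` given by right multiplication with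
`A`, that is, `(x_k)_k ↦ (∑_k x_k · a_{k,j})_j`. -/
def rightMulMatrix {r s : ℕ} (A : Matrix (Fin r) (Fin s) (MonoidAlgebra ℤ G)) :
    L2Pow G r →L[ℂ] L2Pow G s :=
  (PiLp.continuousLinearEquiv 2 ℂ (fun _ : Fin s => L2 G)).symm.toContinuousLinearMap ∘L
    ContinuousLinearMap.pi fun j =>
      ∑ k, rightMul (A k j) ∘L PiLp.proj 2 (fun _ : Fin r => L2 G) k

end Operators

/-! ### Spectral projections -/

section Spectral

variable {H : Type*} [NormedAddCommGroup H] [InnerProductSpace ℂ H] [CompleteSpace H]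

/-- The image of the spectral projection `E_c` of a selfadjoint operator `T`, that is, the
spectral subspace of `T` belonging to `(-∞, c]`: the kernel of the positive part
`(T - c)⁺`. -/
def spectralSubspace (T : H →L[ℂ] H) (c : ℝ) : Submodule ℂ H :=
  (cfc (fun x : ℝ => max (x - c) 0) T).ker

instance (T : H →L[ℂ] H) (c : ℝ) : CompleteSpace (spectralSubspace T c) :=
  inferInstanceAs (CompleteSpace (cfc (fun x : ℝ => max (x - c) 0) T).ker)

/-- The spectral projection `E_c` of a selfadjoint operator `T`. -/
def spectralProjection (T : H →L[ℂ] H) (c : ℝ) : H →L[ℂ] H :=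
  (spectralSubspace T c).starProjection

theorem spectralSubspace_mono (T : H →L[ℂ] H) : Monotone (spectralSubspace T) := by
  intro c d hcd x hx
  rcases hcd.eq_or_lt with rfl | hlt
  · exact hx
  let q : ℝ → ℝ := fun t => max (t - d) 0 / max (t - c) (d - c)
  have hpos : ∀ t : ℝ, max (t - c) (d - c) ≠ 0 := fun t =>
    (lt_of_lt_of_le (sub_pos.mpr hlt) (le_max_right _ _)).ne'
  have hq : Continuous q := by
    refine Continuous.div (by fun_prop) (by fun_prop) hpos
  have key : (fun t : ℝ => max (t - d) 0) = fun t => q t * max (t - c) 0 := by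
    funext t
    simp only [q]
    rcases le_total t d with h | h
    · rw [max_eq_right (by linarith : t - d ≤ 0)]
      simp
    · rw [max_eq_left (by linarith : d - c ≤ t - c), max_eq_left (by linarith : 0 ≤ t - c)]
      have : t - c ≠ 0 := by linarith [sub_pos.mpr hlt] |> fun (h : 0 < t - c) => h.ne'
      field_simp
  change cfc (fun t : ℝ => max (t - c) 0) T x = 0 at hx
  change cfc (fun t : ℝ => max (t - d) 0) T x = 0
  rw [key, cfc_mul (fun t => q t) (fun t => max (t - c) 0) T hq.continuousOn
    (by fun_prop)]
  simp [hx]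

theorem iInf_spectralSubspace (T : H →L[ℂ] H) (c : ℝ) :
    ⨅ n : ℕ, spectralSubspace T (c + 1 / ((n : ℝ) + 1)) = spectralSubspace T c := by
  apply le_antisymm
  · intro x hx
    rw [Submodule.mem_iInf] at hx
    change cfc (fun t : ℝ => max (t - c) 0) T x = 0
    have bound : ∀ n : ℕ,
        ‖cfc (fun t : ℝ => max (t - c) 0) T x‖ ≤ 1 / ((n : ℝ) + 1) * ‖x‖ := by
      intro n
      have hn : (0 : ℝ) ≤ 1 / ((n : ℝ) + 1) := by positivity
      have h0 : cfc (fun t : ℝ => max (t - (c + 1 / ((n : ℝ) + 1))) 0) T x = 0 := hx n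
      have h1 : cfc (fun t : ℝ => max (t - c) 0) T x =
          cfc (fun t : ℝ => max (t - c) 0 - max (t - (c + 1 / ((n : ℝ) + 1))) 0) T x := by
        rw [cfc_sub (fun t : ℝ => max (t - c) 0)
          (fun t : ℝ => max (t - (c + 1 / ((n : ℝ) + 1))) 0) T (by fun_prop) (by fun_prop),
          sub_apply, h0, sub_zero]
      rw [h1]
      refine (ContinuousLinearMap.le_opNorm _ _).trans ?_
      gcongr
      refine norm_cfc_le hn fun t _ => ?_
      rw [Real.norm_eq_abs]
      refine (abs_max_sub_max_le_abs _ _ _).trans ?_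
      rw [show t - c - (t - (c + 1 / ((n : ℝ) + 1))) = 1 / ((n : ℝ) + 1) by ring,
        abs_of_nonneg hn]
    have lim : Filter.Tendsto (fun n : ℕ => 1 / ((n : ℝ) + 1) * ‖x‖) Filter.atTop
        (nhds (0 * ‖x‖)) := tendsto_one_div_add_atTop_nhds_zero_nat.mul_const _
    have := ge_of_tendsto' lim bound
    rw [zero_mul] at this
    exact norm_le_zero_iff.mp this
  · refine le_iInf fun n => spectralSubspace_mono T ?_
    have : (0 : ℝ) ≤ 1 / ((n : ℝ) + 1) := by positivity
    linarith

theorem tendsto_spectralProjection (T : H →L[ℂ] H) (c : ℝ) (x : H) :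
    Filter.Tendsto (fun n : ℕ => spectralProjection T (c + 1 / ((n : ℝ) + 1)) x) Filter.atTop
      (nhds (spectralProjection T c x)) := by
  let K : ℕ → Submodule ℂ H := fun n => spectralSubspace T (c + 1 / ((n : ℝ) + 1))
  have hK : ∀ n, (K n)ᗮᗮ = K n := fun n => by
    have : CompleteSpace (K n) :=
      inferInstanceAs (CompleteSpace (spectralSubspace T (c + 1 / ((n : ℝ) + 1))))
    exact Submodule.orthogonal_orthogonal (K n)
  have hmono : Monotone fun n => (K n)ᗮ := by
    intro m n hmn
    refine Submodule.orthogonal_le (spectralSubspace_mono T ?_)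
    have : 1 / ((n : ℝ) + 1) ≤ 1 / ((m : ℝ) + 1) := by gcongr
    linarith
  have hcl : (⨆ n, (K n)ᗮ).topologicalClosure = (spectralSubspace T c)ᗮ := by
    rw [← Submodule.orthogonal_orthogonal_eq_closure, ← Submodule.iInf_orthogonal]
    simp only [hK]
    rw [iInf_spectralSubspace T c]
  have h := Submodule.starProjection_tendsto_closure_iSup (fun n => (K n)ᗮ) hmono x
  simp only [hcl] at h
  have h2 := h.const_sub x
  simpa [K, Submodule.starProjection_orthogonal, spectralProjection] using h2

theorem inner_spectralProjection_nonneg (T : H →L[ℂ] H) (c : ℝ) (x : H) :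
    0 ≤ (inner ℂ x (spectralProjection T c x)).re :=
  (ContinuousLinearMap.IsPositive.of_isStarProjection
    (isStarProjection_starProjection (U := spectralSubspace T c))).re_inner_nonneg_right x

theorem inner_spectralProjection_mono (T : H →L[ℂ] H) (x : H) :
    Monotone fun c => (inner ℂ x (spectralProjection T c x)).re := by
  intro c d hcd
  have h : spectralProjection T c ≤ spectralProjection T d :=
    Submodule.starProjection_le_starProjection_iff.mpr (spectralSubspace_mono T hcd)
  have := ((ContinuousLinearMap.le_def _ _).mp h).re_inner_nonneg_right x
  simpa [inner_sub_right] using this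

end Spectral

/-! ### Von Neumann trace and dimension -/

section FugledeKadison

variable {G : Type*} [Group G]

open Classical in
/-- The unit element `e ∈ G ⊆ L²(G)`. -/
def unitVector (G : Type*) [Group G] : L2 G := lp.single 2 (1 : G) (1 : ℂ)

/-- The element of `L²(G)^r` with the unit element of `G` as its `i`-th entry and zeros
elsewhere. -/
def basisVector (G : Type*) [Group G] {r : ℕ} (i : Fin r) : L2Pow G r :=
  PiLp.single 2 i (unitVector G)

/-- The von Neumann trace of a bounded `G`-equivariant operator `f` on `L²(G)^r`: the sum of the
traces `⟨f_{i,i}(e), e⟩` of its diagonal entries. -/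
def vonNeumannTrace {r : ℕ} (f : L2Pow G r →L[ℂ] L2Pow G r) : ℂ :=
  ∑ i, inner ℂ (basisVector G i) (f (basisVector G i))

/-- The von Neumann dimension of a closed `G`-invariant subspace `V` of `L²(G)^r`: the trace of
the orthogonal projection onto `V` (this trace is real). -/
def vonNeumannDim {r : ℕ} (V : Submodule ℂ (L2Pow G r)) [V.HasOrthogonalProjection] : ℝ :=
  (vonNeumannTrace V.starProjection).re

/-! ### The Fuglede-Kadison determinant -/

/-- The spectral density function `F_f(t) = dim (im E_{t²}^{f^* f})` for `t ≥ 0`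
(and `0` for `t < 0`). -/
def spectralDensity {r s : ℕ} (f : L2Pow G r →L[ℂ] L2Pow G s) (t : ℝ) : ℝ :=
  if 0 ≤ t then vonNeumannDim (spectralSubspace (f.adjoint ∘L f) (t ^ 2)) else 0

theorem vonNeumannDim_spectralSubspace {r : ℕ} (T : L2Pow G r →L[ℂ] L2Pow G r) (c : ℝ) :
    vonNeumannDim (spectralSubspace T c) =
      ∑ i, (inner ℂ (basisVector G i) (spectralProjection T c (basisVector G i))).re := by
  simp [vonNeumannDim, vonNeumannTrace, spectralProjection]

theorem spectralDensity_mono {r s : ℕ} (f : L2Pow G r →L[ℂ] L2Pow G s) :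
    Monotone (spectralDensity f) := by
  intro t u htu
  unfold spectralDensity
  split_ifs with h1 h2 h2
  · simp only [vonNeumannDim_spectralSubspace]
    exact Finset.sum_le_sum fun i _ => inner_spectralProjection_mono _ _ (by gcongr)
  · exact absurd (h1.trans htu) h2
  · rw [vonNeumannDim_spectralSubspace]
    exact Finset.sum_nonneg fun i _ => inner_spectralProjection_nonneg _ _ _
  · exact le_rfl

theorem spectralDensity_rightCont {r s : ℕ} (f : L2Pow G r →L[ℂ] L2Pow G s) (t : ℝ) :
    ContinuousWithinAt (spectralDensity f) (Set.Ici t) t := by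
  rw [← continuousWithinAt_Ioi_iff_Ici]
  have hlim := (spectralDensity_mono f).tendsto_nhdsGT t
  suffices h : sInf (spectralDensity f '' Set.Ioi t) = spectralDensity f t by
    rw [h] at hlim
    exact hlim
  rcases lt_or_ge t 0 with ht | ht
  · refine tendsto_nhds_unique hlim (tendsto_const_nhds.congr' ?_)
    filter_upwards [Ioo_mem_nhdsGT ht] with u hu
    simp [spectralDensity, not_le.mpr ht, not_le.mpr hu.2]
  · let T := f.adjoint ∘L f
    let u : ℕ → ℝ := fun n => Real.sqrt (t ^ 2 + 1 / ((n : ℝ) + 1))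
    have hpos : ∀ n : ℕ, (0 : ℝ) < 1 / ((n : ℝ) + 1) := fun n => by positivity
    have hu : Filter.Tendsto u Filter.atTop (nhdsWithin t (Set.Ioi t)) := by
      refine tendsto_nhdsWithin_iff.mpr ⟨?_, Filter.Eventually.of_forall fun n => ?_⟩
      · have h := (tendsto_one_div_add_atTop_nhds_zero_nat (𝕜 := ℝ)).const_add (t ^ 2)
        have h' := (Real.continuous_sqrt.tendsto _).comp h
        simpa [Real.sqrt_sq ht, Function.comp_def, u] using h'
      · exact Real.lt_sqrt_of_sq_lt (by linarith [hpos n])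
    refine tendsto_nhds_unique (hlim.comp hu) ?_
    have hval : ∀ n, spectralDensity f (u n) = ∑ i, (inner ℂ (basisVector G i)
        (spectralProjection T (t ^ 2 + 1 / ((n : ℝ) + 1)) (basisVector G i))).re := fun n => by
      have hsq : u n ^ 2 = t ^ 2 + 1 / ((n : ℝ) + 1) :=
        Real.sq_sqrt (by have := hpos n; positivity)
      rw [← hsq, ← vonNeumannDim_spectralSubspace]
      exact if_pos (Real.sqrt_nonneg _)
    have hval0 : spectralDensity f t = ∑ i, (inner ℂ (basisVector G i)
        (spectralProjection T (t ^ 2) (basisVector G i))).re := by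
      rw [← vonNeumannDim_spectralSubspace]
      simp [spectralDensity, ht, T]
    rw [hval0]
    simp only [Function.comp_def, hval]
    refine tendsto_finsetSum _ fun i _ => ?_
    exact (Complex.continuous_re.tendsto _).comp
      (tendsto_const_nhds.inner (tendsto_spectralProjection T _ _))

/-- The spectral density function as a monotone right-continuous function. Its measure `dF`
satisfies `dF (]a, b]) = F(b) - F(a)`. -/
def spectralStieltjes {r s : ℕ} (f : L2Pow G r →L[ℂ] L2Pow G s) : StieltjesFunction ℝ where
  toFun := spectralDensity f
  mono' := spectralDensity_mono f
  right_continuous' := spectralDensity_rightCont f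

open Classical in
/-- The Fuglede-Kadison determinant of `f`: the number `exp (∫_{0+}^∞ ln t dF_f(t))` if the
integral converges, and `0` otherwise. -/
def fkDet {r s : ℕ} (f : L2Pow G r →L[ℂ] L2Pow G s) : ℝ :=
  if IntegrableOn Real.log (Set.Ioi 0) (spectralStieltjes f).measure then
    Real.exp (∫ t in Set.Ioi 0, Real.log t ∂(spectralStieltjes f).measure)
  else 0

end FugledeKadison

/-! ### The four Lehmer constants -/

section Constants

variable (G : Type*) [Group G]

/-- A weak isomorphism: an injective operator with dense image. -/
def IsWeakIso {G : Type*} {r s : ℕ} (f : L2Pow G r →L[ℂ] L2Pow G s) : Prop :=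
  Function.Injective f ∧ DenseRange f

/-- `Λ(G)`: all matrices over the integral group ring. -/
def lehmer : ℝ :=
  sInf {d : ℝ | 1 < d ∧ ∃ r s : ℕ, 1 ≤ r ∧ 1 ≤ s ∧
    ∃ A : Matrix (Fin r) (Fin s) (MonoidAlgebra ℤ G), fkDet (rightMulMatrix A) = d}

/-- `Λ₁(G)`: all `(1,1)`-matrices. -/
def lehmerOne : ℝ :=
  sInf {d : ℝ | 1 < d ∧
    ∃ A : Matrix (Fin 1) (Fin 1) (MonoidAlgebra ℤ G), fkDet (rightMulMatrix A) = d}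

/-- `Λ^w(G)`: all square matrices that induce a weak isomorphism. -/
def lehmerW : ℝ :=
  sInf {d : ℝ | 1 < d ∧ ∃ r : ℕ, 1 ≤ r ∧
    ∃ A : Matrix (Fin r) (Fin r) (MonoidAlgebra ℤ G),
      IsWeakIso (rightMulMatrix A) ∧ fkDet (rightMulMatrix A) = d}

/-- `Λ₁^w(G)`: all `(1,1)`-matrices that induce a weak isomorphism. -/
def lehmerWOne : ℝ :=
  sInf {d : ℝ | 1 < d ∧
    ∃ A : Matrix (Fin 1) (Fin 1) (MonoidAlgebra ℤ G),
      IsWeakIso (rightMulMatrix A) ∧ fkDet (rightMulMatrix A) = d}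

end Constants

end Lehmer

end

/-!
For a finite subgroup `K` of a group `G`, let `e` be the projection of `L²(G)` onto the
`K`-invariant vectors. Right multiplication by `1 + ∑_{k ∈ K} k` is `(1 - e) + (1 + |K|) e`, which
is invertible, and `e` has trace `1 / |K|`, so the Fuglede-Kadison determinant is
`(1 + |K|) ^ (1 / |K|)`. This tends to `1` from above as `|K|` grows, so all four constants are `1`
whenever `G` has arbitrarily large finite subgroups, a property inherited by overgroups.

A finitely presented overgroup of the lamplighter group is Baumslag's group
`⟨a, s, t | a², [s, t], [a, a^t], a^s = a a^t⟩`: conjugating by `s` propagates the one commutator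
relation to all conjugates of `a` by powers of `t`. The lamplighter group maps injectively to it
because it acts faithfully on the Laurent series over `𝔽₂` by `a : z ↦ z + 1` and `t : z ↦ X z`,
and this action extends to Baumslag's group by `s : z ↦ (1 + X) z`.
-/

namespace Lehmer

section LampConfigurations

variable {ι G : Type*} [Group G] {n : ℕ}

open scoped IsMulCommutative in
/-- The homomorphism `⨁_ι ℤ/n → G` that sends the `i`-th generator to `c i`, for a commuting
family `c` of elements whose order divides `n`. -/
noncomputable def zmodFinsuppLift (c : ι → G) (hpow : ∀ i, c i ^ n = 1)
    (hcomm : ∀ i j, Commute (c i) (c j)) : Multiplicative (ι →₀ ZMod n) →* G :=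
  have : IsMulCommutative (Subgroup.closure (Set.range c)) := Subgroup.isMulCommutative_closure
    (Set.forall_mem_range.mpr fun i => Set.forall_mem_range.mpr fun j => (hcomm i j).eq)
  let e (i : ι) : ZMod n →+ Additive (Subgroup.closure (Set.range c)) :=
    ZMod.lift n ⟨zmultiplesHom _ (.ofMul ⟨c i, Subgroup.subset_closure ⟨i, rfl⟩⟩), by
      rw [zmultiplesHom_apply, natCast_zsmul]
      exact congrArg Additive.ofMul (Subtype.ext (hpow i))⟩
  (Subgroup.subtype _).comp (Finsupp.liftAddHom e).toMultiplicativeLeft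

theorem zmodFinsuppLift_single (c : ι → G) (hpow : ∀ i, c i ^ n = 1)
    (hcomm : ∀ i j, Commute (c i) (c j)) (i : ι) :
    zmodFinsuppLift c hpow hcomm (.ofAdd (.single i 1)) = c i := by
  have hone : (1 : ZMod n) = ((1 : ℤ) : ZMod n) := Int.cast_one.symm
  simp [zmodFinsuppLift, hone, -Int.cast_one]

theorem closure_range_ofAdd_single :
    Subgroup.closure (Set.range fun i : ι => Multiplicative.ofAdd (Finsupp.single i (1 : ZMod n))) =
      ⊤ := by
  refine (Subgroup.eq_top_iff' _).mpr fun u => ?_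
  rw [← ofAdd_toAdd u]
  induction u.toAdd using Finsupp.induction_linear with
  | zero => exact one_mem _
  | add u v hu hv => exact mul_mem hu hv
  | single i c =>
    obtain ⟨m, rfl⟩ := ZMod.intCast_surjective c
    have hm : Finsupp.single i (m : ZMod n) = m • Finsupp.single i 1 := by simp
    rw [hm, ofAdd_zsmul]
    exact zpow_mem (Subgroup.subset_closure (Set.mem_range_self i)) m

theorem zmodFinsupp_hom_ext {f g : Multiplicative (ι →₀ ZMod n) →* G}
    (h : ∀ i, f (.ofAdd (.single i 1)) = g (.ofAdd (.single i 1))) : f = g :=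
  MonoidHom.eq_of_eqOn_dense closure_range_ofAdd_single (Set.forall_mem_range.mpr h)

end LampConfigurations

namespace Lamplighter

/-- The configuration in which only the lamp at `k` is on. -/
noncomputable def lamp (k : ℤ) : Lamplighter := .inl (.ofAdd (.single k 1))

/-- The generator of the factor `ℤ`, which moves the lamplighter by one step. -/
noncomputable def shift : Lamplighter := .inr (.ofAdd 1)

theorem inr_ofAdd (n : ℤ) : (.inr (.ofAdd n) : Lamplighter) = shift ^ n := by
  rw [shift, ← map_zpow, ← ofAdd_zsmul, smul_eq_mul, mul_one]

theorem lampShift_single (n : Multiplicative ℤ) (k : ℤ) (c : ZMod 2) :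
    lampShift n (.ofAdd (.single k c)) = .ofAdd (.single (k + n.toAdd) c) :=
  congrArg Multiplicative.ofAdd (Finsupp.equivMapDomain_single _ _ _)

theorem lamp_eq_conj (k : ℤ) : lamp k = MulAut.conj (shift ^ k) (lamp 0) := by
  rw [← inr_ofAdd, MulAut.conj_apply, lamp, lamp, ← map_inv, ← SemidirectProduct.inl_aut,
    lampShift_single, zero_add, toAdd_ofAdd]

theorem closure_lamp_shift : Subgroup.closure {lamp 0, shift} = ⊤ := by
  have hlamp : lamp 0 ∈ Subgroup.closure {lamp 0, shift} := Subgroup.subset_closure (.inl rfl)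
  have hshift : shift ∈ Subgroup.closure {lamp 0, shift} := Subgroup.subset_closure (.inr rfl)
  have hconfig : (SemidirectProduct.inl : _ →* Lamplighter).range ≤
      Subgroup.closure {lamp 0, shift} := by
    rw [MonoidHom.range_eq_map, ← closure_range_ofAdd_single, MonoidHom.map_closure,
      Subgroup.closure_le]
    rintro _ ⟨_, ⟨k, rfl⟩, rfl⟩
    change lamp k ∈ Subgroup.closure {lamp 0, shift}
    rw [lamp_eq_conj k]
    exact mul_mem (mul_mem (zpow_mem hshift k) hlamp) (inv_mem (zpow_mem hshift k))
  refine (Subgroup.eq_top_iff' _).mpr fun w => ?_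
  rw [← SemidirectProduct.inl_left_mul_inr_right w, ← ofAdd_toAdd w.right, inr_ofAdd]
  exact mul_mem (hconfig ⟨_, rfl⟩) (zpow_mem hshift _)

theorem fg : Group.FG Lamplighter :=
  Group.fg_iff.mpr ⟨_, closure_lamp_shift, by simp⟩

variable {G : Type*} [Group G]

/-- The homomorphism from the lamplighter group that sends the lamp at `0` to the involution `a`
and the shift to `t`, provided that the conjugates of `a` by the powers of `t` commute. -/
noncomputable def lift (a t : G) (ha : a ^ 2 = 1)
    (hcomm : ∀ i j : ℤ, Commute (MulAut.conj (t ^ i) a) (MulAut.conj (t ^ j) a)) :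
    Lamplighter →* G :=
  SemidirectProduct.lift
    (zmodFinsuppLift (fun k : ℤ => MulAut.conj (t ^ k) a)
      (fun k => by rw [← map_pow, ha, map_one]) hcomm)
    (zpowersHom G t) fun n => zmodFinsupp_hom_ext fun k => by
      simp only [MonoidHom.comp_apply, MulEquiv.coe_toMonoidHom, lampShift_single,
        zmodFinsuppLift_single, zpowersHom_apply]
      rw [← MulAut.mul_apply, ← map_mul, ← zpow_add, add_comm]

variable {a t : G} (ha : a ^ 2 = 1)
  (hcomm : ∀ i j : ℤ, Commute (MulAut.conj (t ^ i) a) (MulAut.conj (t ^ j) a))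

theorem lift_lamp_zero : lift a t ha hcomm (lamp 0) = a := by
  simp [lift, lamp, zmodFinsuppLift_single]

theorem lift_shift : lift a t ha hcomm shift = t := by
  simp [lift, shift]

end Lamplighter

section BaumslagGroup

variable {G : Type*} [Group G]

/-- The defining relations of Baumslag's metabelian group, for elements `a`, `s`, `t`. -/
structure IsBaumslagTriple (a s t : G) : Prop where
  sq_eq_one : a ^ 2 = 1
  commute : Commute s t
  commute_conj : Commute a (MulAut.conj t a)
  conj_eq : MulAut.conj s a = a * MulAut.conj t a

-- Write `b k = t ^ k a t ^ (-k)`. Conjugating `[b 0, b (n + 1)] = 1` with `s` shows that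
-- `b 0 * b 1` commutes with `b (n + 1) * b (n + 2)`, and the other three commutators are trivial
-- by induction.
theorem IsBaumslagTriple.commute_conj_pow {a s t : G} (h : IsBaumslagTriple a s t) (n : ℕ) :
    Commute a (MulAut.conj (t ^ n) a) := by
  let b (k : ℕ) : G := MulAut.conj (t ^ k) a
  have conj_t (k : ℕ) : MulAut.conj t (b k) = b (k + 1) := by
    rw [← MulAut.mul_apply, ← map_mul, ← pow_succ']
  have conj_s (k : ℕ) : MulAut.conj s (b k) = b k * b (k + 1) := by
    rw [← MulAut.mul_apply, ← map_mul, (h.commute.pow_right k).eq, map_mul, MulAut.mul_apply,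
      h.conj_eq, map_mul, ← MulAut.mul_apply, ← map_mul, ← pow_succ]
  change Commute a (b n)
  have b_zero : b 0 = a := by simp [b]
  rw [← b_zero]
  induction n using Nat.twoStepInduction with
  | zero => exact .refl _
  | one => simpa [b] using h.commute_conj
  | more n ih₀ ih₁ =>
    have h₁₁ : Commute (b 1) (b (n + 1)) := by simpa only [conj_t] using ih₀.map (MulAut.conj t)
    have h₁₂ : Commute (b 1) (b (n + 2)) := by simpa only [conj_t] using ih₁.map (MulAut.conj t)
    have hs : Commute (b 0 * b 1) (b (n + 1) * b (n + 2)) := by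
      simpa only [conj_s] using ih₁.map (MulAut.conj s)
    have h₂ : Commute (b 0 * b 1) (b (n + 2)) := by
      simpa using (ih₁.mul_left h₁₁).inv_right.mul_right hs
    simpa using h₂.mul_left h₁₂.inv_left

theorem IsBaumslagTriple.commute_conj_zpow {a s t : G} (h : IsBaumslagTriple a s t) (i j : ℤ) :
    Commute (MulAut.conj (t ^ i) a) (MulAut.conj (t ^ j) a) := by
  wlog hij : i ≤ j generalizing i j
  · exact (this j i (le_of_not_ge hij)).symm
  obtain ⟨n, rfl⟩ := Int.le.dest hij
  have := (h.commute_conj_pow n).map (MulAut.conj (t ^ i))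
  rwa [← MulAut.mul_apply, ← map_mul, ← zpow_natCast, ← zpow_add] at this

/-- The relators of Baumslag's group, for the generators `a`, `s`, `t` numbered `0`, `1`, `2`:
the relations of `IsBaumslagTriple` in the form `u * v⁻¹`. -/
def baumslagRels : Set (FreeGroup (Fin 3)) :=
  let a := FreeGroup.of 0
  let s := FreeGroup.of 1
  let t := FreeGroup.of 2
  {a ^ 2, s * t * (t * s)⁻¹, a * MulAut.conj t a * (MulAut.conj t a * a)⁻¹,
    MulAut.conj s a * (a * MulAut.conj t a)⁻¹}

/-- Baumslag's finitely presented metabelian group. -/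
abbrev BaumslagGroup : Type := PresentedGroup baumslagRels

namespace BaumslagGroup

theorem isFinitelyPresented : Group.IsFinitelyPresented BaumslagGroup := by
  have : Finite baumslagRels := Set.Finite.to_subtype (by simp [baumslagRels])
  infer_instance

theorem isBaumslagTriple_of : IsBaumslagTriple (.of 0 : BaumslagGroup) (.of 1) (.of 2) := by
  have mk_eq_mk {u v : FreeGroup (Fin 3)} (h : u * v⁻¹ ∈ baumslagRels) :
      PresentedGroup.mk baumslagRels u = PresentedGroup.mk baumslagRels v :=
    mul_inv_eq_one.mp (PresentedGroup.one_of_mem h)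
  exact
  { sq_eq_one := PresentedGroup.one_of_mem (.inl rfl)
    commute := mk_eq_mk (.inr (.inl rfl))
    commute_conj := mk_eq_mk (.inr (.inr (.inl rfl)))
    conj_eq := mk_eq_mk (.inr (.inr (.inr rfl))) }

/-- The homomorphism from Baumslag's group given by elements that satisfy its relations. -/
def lift {a s t : G} (h : IsBaumslagTriple a s t) : BaumslagGroup →* G :=
  PresentedGroup.toGroup (f := ![a, s, t]) <| by
    rintro _ (rfl | rfl | rfl | rfl)
    · simpa using h.sq_eq_one
    · simpa using mul_inv_eq_one.mpr h.commute.eq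
    · simpa using mul_inv_eq_one.mpr h.commute_conj.eq
    · simpa using mul_inv_eq_one.mpr h.conj_eq

/-- The homomorphism from the lamplighter group to Baumslag's group. -/
noncomputable def ofLamplighter : Lamplighter →* BaumslagGroup :=
  Lamplighter.lift _ _ isBaumslagTriple_of.sq_eq_one isBaumslagTriple_of.commute_conj_zpow

section Lift

variable {a s t : G} (h : IsBaumslagTriple a s t)

theorem lift_ofLamplighter_lamp_zero : lift h (ofLamplighter (Lamplighter.lamp 0)) = a := by
  simp [lift, ofLamplighter, Lamplighter.lift_lamp_zero]

theorem lift_ofLamplighter_shift : lift h (ofLamplighter Lamplighter.shift) = t := by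
  simp [lift, ofLamplighter, Lamplighter.lift_shift]

end Lift

end BaumslagGroup

end BaumslagGroup

section AffineAction

variable {R : Type*} [CommRing R]

theorem isBaumslagTriple_affine [CharP R 2] (x y : Rˣ) (hxy : (y : R) = 1 + x) :
    IsBaumslagTriple (Equiv.addLeft (1 : R)) (MulAction.toPerm y) (MulAction.toPerm x) := by
  have hconj (u : Rˣ) :
      MulAut.conj (MulAction.toPerm u) (Equiv.addLeft (1 : R)) = Equiv.addLeft (u : R) := by
    ext z
    simp [Units.smul_def]
  exact
  { sq_eq_one := by
      ext z
      simp [pow_two, ← add_assoc, CharTwo.add_self_eq_zero]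
    commute := (Commute.all y x).map (MulAction.toPermHom Rˣ R)
    commute_conj := by
      rw [hconj]
      ext z
      exact add_left_comm _ _ _
    conj_eq := by
      rw [hconj, hconj, hxy]
      ext z
      exact add_assoc _ _ _ }

end AffineAction

namespace Lamplighter

variable {R : Type*} [Ring R] [Module (ZMod 2) R] {x : Rˣ} {ψ : Lamplighter →* Equiv.Perm R}

theorem apply_of_affine (hlamp : ψ (lamp 0) = Equiv.addLeft 1)
    (hshift : ψ shift = MulAction.toPerm x) (w : Lamplighter) (z : R) :
    ψ w z = Finsupp.linearCombination (ZMod 2) (fun k : ℤ => ((x ^ k : Rˣ) : R)) w.left.toAdd +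
      ↑(x ^ w.right.toAdd) * z := by
  have hpow (n : ℤ) : ψ (shift ^ n) = MulAction.toPerm (x ^ n) := by
    rw [map_zpow, hshift]
    exact (map_zpow (MulAction.toPermHom Rˣ R) x n).symm
  have hinl : ψ.comp SemidirectProduct.inl = AddMonoidHom.toMultiplicativeLeft
      ((AddAction.toPermHom R R).comp
        (Finsupp.linearCombination (ZMod 2) fun k : ℤ => ((x ^ k : Rˣ) : R)).toAddMonoidHom) := by
    refine zmodFinsupp_hom_ext fun k => ?_
    change ψ (lamp k) = _
    rw [lamp_eq_conj k, MulAut.conj_apply, map_mul, map_mul, map_inv, hpow, hlamp]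
    ext z
    have hz : (↑(x ^ k) * (1 + ↑(x ^ k)⁻¹ * z) : R) = Finsupp.linearCombination (ZMod 2)
        (fun k : ℤ => ((x ^ k : Rˣ) : R)) (.single k 1) + z := by simp [mul_add]
    exact hz
  conv_lhs => rw [← SemidirectProduct.inl_left_mul_inr_right w, ← ofAdd_toAdd w.right, inr_ofAdd]
  rw [map_mul, hpow, ← MonoidHom.comp_apply, hinl]
  rfl

theorem injective_of_affine (hx : LinearIndependent (ZMod 2) fun k : ℤ => ((x ^ k : Rˣ) : R))
    (hlamp : ψ (lamp 0) = Equiv.addLeft 1) (hshift : ψ shift = MulAction.toPerm x) :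
    Function.Injective ψ := by
  refine (injective_iff_map_eq_one ψ).mpr fun w hw => ?_
  have happly (z : R) := apply_of_affine hlamp hshift w z
  simp only [hw, Equiv.Perm.one_apply] at happly
  have hleft : w.left.toAdd = 0 := by
    refine linearIndependent_iff.mp hx _ ?_
    simpa using (happly 0).symm
  have hright : w.right.toAdd = 0 := hx.injective <| by
    simpa [hleft] using (happly 1).symm
  exact SemidirectProduct.ext hleft hright

end Lamplighter

section LaurentSeries

theorem linearIndependent_hahnSeries_single (Γ R : Type*) [PartialOrder Γ] [Semiring R] :
    LinearIndependent R fun g : Γ => (HahnSeries.single g 1 : HahnSeries Γ R) := by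
  classical
  refine LinearIndependent.of_comp (LinearMap.pi fun g => HahnSeries.coeff.linearMap g) ?_
  convert! Pi.linearIndependent_single_one Γ R

theorem BaumslagGroup.ofLamplighter_injective : Function.Injective ofLamplighter := by
  have : CharP (LaurentSeries (ZMod 2)) 2 :=
    charP_of_injective_algebraMap (algebraMap (ZMod 2) _).injective 2
  let x : (LaurentSeries (ZMod 2))ˣ := .mk0 (HahnSeries.single 1 1) (by simp)
  have hX : (1 : LaurentSeries (ZMod 2)) + HahnSeries.single 1 1 ≠ 0 := fun h => by
    simpa using congrArg (HahnSeries.coeff · 0) h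
  let y : (LaurentSeries (ZMod 2))ˣ := .mk0 (1 + HahnSeries.single 1 1) hX
  have h := isBaumslagTriple_affine x y rfl
  have hx : LinearIndependent (ZMod 2) fun n : ℤ => ((x ^ n : _ˣ) : LaurentSeries (ZMod 2)) := by
    simp only [Units.val_zpow_eq_zpow_val, x, Units.val_mk0, ← RatFunc.single_zpow]
    exact linearIndependent_hahnSeries_single ℤ (ZMod 2)
  exact .of_comp (f := lift h) <| Lamplighter.injective_of_affine (x := x)
    (ψ := (lift h).comp ofLamplighter) hx
    (lift_ofLamplighter_lamp_zero h) (lift_ofLamplighter_shift h)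

end LaurentSeries

section LargeFiniteSubgroups

/-- The group has finite subgroups of arbitrarily large order. -/
def HasArbitrarilyLargeFiniteSubgroups (G : Type*) [Group G] : Prop :=
  ∀ n : ℕ, ∃ K : Subgroup G, Finite K ∧ n ≤ Nat.card K

namespace HasArbitrarilyLargeFiniteSubgroups

variable {G H : Type*} [Group G] [Group H]

theorem of_injective (hG : HasArbitrarilyLargeFiniteSubgroups G) {f : G →* H}
    (hf : Function.Injective f) : HasArbitrarilyLargeFiniteSubgroups H := by
  intro n
  obtain ⟨K, hK, hn⟩ := hG n
  let e := K.equivMapOfInjective f hf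
  exact ⟨K.map f, .of_equiv K e.toEquiv, hn.trans_eq (Nat.card_congr e.toEquiv)⟩

theorem finsupp (ι M : Type*) [Infinite ι] [AddCommGroup M] [Finite M] [Nontrivial M] :
    HasArbitrarilyLargeFiniteSubgroups (Multiplicative (ι →₀ M)) := by
  intro n
  let f := (Finsupp.mapDomain.addMonoidHom (M := M) fun k : Fin n =>
    Infinite.natEmbedding ι k).toMultiplicative
  have hf : Function.Injective f :=
    Finsupp.mapDomain_injective ((Infinite.natEmbedding ι).injective.comp Fin.val_injective)
  have := Fintype.ofFinite M
  refine ⟨f.range, Set.finite_range f, ?_⟩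
  calc n ≤ Nat.card M ^ n := (Nat.lt_pow_self Finite.one_lt_card).le
    _ = Nat.card (Multiplicative (Fin n →₀ M)) := by
      rw [Nat.card_congr Multiplicative.toAdd]
      simp [Nat.card_eq_fintype_card]
    _ = Nat.card f.range := Nat.card_congr (MonoidHom.ofInjective hf).toEquiv

theorem lamplighter : HasArbitrarilyLargeFiniteSubgroups Lamplighter :=
  (finsupp ℤ (ZMod 2)).of_injective SemidirectProduct.inl_injective

end HasArbitrarilyLargeFiniteSubgroups

end LargeFiniteSubgroups

section TwoValued

variable {𝕜 A : Type*} [Ring A] {p : A}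

/-- For an idempotent `p`, the element of the algebra that acts as `α` on the image of `1 - p` and
as `β` on the image of `p`. -/
def twoValued [CommRing 𝕜] [Algebra 𝕜 A] (p : A) (α β : 𝕜) : A := α • (1 - p) + β • p

section CommRing

variable [CommRing 𝕜] [Algebra 𝕜 A]

theorem twoValued_one_one (p : A) : twoValued p (1 : 𝕜) 1 = 1 := by
  simp [twoValued]

theorem one_sub_twoValued (p : A) (α β : 𝕜) :
    1 - twoValued p α β = twoValued p (1 - α) (1 - β) := by
  simp only [twoValued]
  module

theorem twoValued_mul_twoValued (hp : IsIdempotentElem p) (α β γ δ : 𝕜) :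
    twoValued p α β * twoValued p γ δ = twoValued p (α * γ) (β * δ) := by
  simp only [twoValued, add_mul, mul_add, smul_mul_smul_comm, hp.one_sub.eq, hp.eq,
    hp.mul_one_sub_self, hp.one_sub_mul_self, smul_zero, add_zero, zero_add]

variable [StarRing 𝕜] [StarRing A] [StarModule 𝕜 A]

theorem isSelfAdjoint_twoValued (hp : IsSelfAdjoint p) {α β : 𝕜} (hα : IsSelfAdjoint α)
    (hβ : IsSelfAdjoint β) : IsSelfAdjoint (twoValued p α β) := by
  simp [twoValued, isSelfAdjoint_iff, hp.star_eq, hα.star_eq, hβ.star_eq]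

theorem isStarProjection_twoValued (hp : IsStarProjection p) {α β : 𝕜}
    (hα : IsStarProjection α) (hβ : IsStarProjection β) : IsStarProjection (twoValued p α β) where
  isIdempotentElem := by
    rw [IsIdempotentElem, twoValued_mul_twoValued hp.isIdempotentElem, hα.isIdempotentElem.eq,
      hβ.isIdempotentElem.eq]
  isSelfAdjoint :=
    isSelfAdjoint_twoValued hp.isSelfAdjoint hα.isSelfAdjoint hβ.isSelfAdjoint

end CommRing

theorem isUnit_twoValued [Field 𝕜] [Algebra 𝕜 A] (hp : IsIdempotentElem p) {α β : 𝕜}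
    (hα : α ≠ 0) (hβ : β ≠ 0) : IsUnit (twoValued p α β) := by
  refine isUnit_iff_exists.mpr ⟨twoValued p α⁻¹ β⁻¹, ?_, ?_⟩ <;>
    simp [twoValued_mul_twoValued hp, hα, hβ, twoValued_one_one]

theorem twoValued_ofReal [Algebra ℂ A] (p : A) (α β : ℝ) :
    twoValued p (α : ℂ) (β : ℂ) = twoValued p α β := by
  simp only [twoValued, Complex.coe_smul]

section CFC

variable [Algebra ℝ A] [StarRing A] [TopologicalSpace A]
  [ContinuousFunctionalCalculus ℝ A IsSelfAdjoint]

theorem cfc_eq_twoValued (hp : IsStarProjection p) (g : ℝ → ℝ) :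
    cfc g p = twoValued p (g 0) (g 1) := by
  have hp' := hp.isSelfAdjoint
  have hg : (spectrum ℝ p).EqOn g fun x => g 0 + (g 1 - g 0) * x := fun x hx => by
    rcases hp.isIdempotentElem.spectrum_subset ℝ hx with rfl | rfl <;> simp
  rw [cfc_congr hg, cfc_const_add _ _ p, cfc_const_mul_id _ p, Algebra.algebraMap_eq_smul_one,
    twoValued]
  module

theorem cfc_twoValued [T2Space A] (hp : IsStarProjection p) (g : ℝ → ℝ) (α β : ℝ) :
    cfc g (twoValued p α β) = twoValued p (g α) (g β) := by
  have hspec : (spectrum ℝ p).Finite :=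
    (Set.toFinite {0, 1}).subset (hp.isIdempotentElem.spectrum_subset ℝ)
  let h (x : ℝ) : ℝ := if x = 0 then α else β
  have hh : twoValued p α β = cfc h p := by simp [cfc_eq_twoValued hp, h]
  rw [hh, ← cfc_comp' g h p ((hspec.image h).continuousOn g) (hspec.continuousOn h)
    hp.isSelfAdjoint, cfc_eq_twoValued hp]
  simp [h]

end CFC

end TwoValued

section Spectral

theorem ker_twoValued_le {𝕜 E : Type*} [NormedField 𝕜] [NormedAddCommGroup E] [NormedSpace 𝕜 E]
    {P : E →L[𝕜] E} (hP : IsIdempotentElem P) {α β γ δ : 𝕜} (hα : α = 0 → γ = 0)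
    (hβ : β = 0 → δ = 0) : (twoValued P α β).ker ≤ (twoValued P γ δ).ker := by
  have hmul : twoValued P γ δ = twoValued P (γ / α) (δ / β) * twoValued P α β := by
    rw [twoValued_mul_twoValued hP, div_mul_cancel_of_imp hα, div_mul_cancel_of_imp hβ]
  rw [hmul]
  exact LinearMap.ker_le_ker_comp _ _

variable {H : Type*} [NormedAddCommGroup H] [InnerProductSpace ℂ H] [CompleteSpace H]
  {P : H →L[ℂ] H}

theorem adjoint_comp_twoValued (hP : IsStarProjection P) (α β : ℝ) :
    (twoValued P (α : ℂ) β).adjoint ∘L twoValued P (α : ℂ) β =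
      twoValued P ((α ^ 2 : ℝ) : ℂ) (β ^ 2 : ℝ) := by
  rw [(isSelfAdjoint_twoValued hP.isSelfAdjoint (Complex.conj_ofReal α)
    (Complex.conj_ofReal β)).adjoint_eq, Complex.ofReal_pow, Complex.ofReal_pow, pow_two, pow_two]
  exact twoValued_mul_twoValued hP.isIdempotentElem _ _ _ _

theorem spectralProjection_twoValued (hP : IsStarProjection P) (α β c : ℝ) :
    spectralProjection (twoValued P (α : ℂ) β) c =
      twoValued P (if α ≤ c then 1 else 0 : ℂ) (if β ≤ c then 1 else 0) := by
  let Q := twoValued P (if α ≤ c then 1 else 0 : ℂ) (if β ≤ c then 1 else 0)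
  have hQ : IsStarProjection Q := isStarProjection_twoValued hP
    (by split_ifs <;> simp) (by split_ifs <;> simp)
  have hker : spectralSubspace (twoValued P (α : ℂ) β) c = Q.range := by
    have hQ_range : Q.range = (1 - Q).ker :=
      LinearMap.IsIdempotentElem.range_eq_ker_one_sub
        (ContinuousLinearMap.IsIdempotentElem.toLinearMap hQ.isIdempotentElem)
    rw [hQ_range, one_sub_twoValued, spectralSubspace, twoValued_ofReal, cfc_twoValued hP,
      ← twoValued_ofReal]
    refine le_antisymm (ker_twoValued_le hP.isIdempotentElem ?_ ?_)
      (ker_twoValued_le hP.isIdempotentElem ?_ ?_) <;> norm_cast <;> grind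
  obtain ⟨_, hrange⟩ := isStarProjection_iff_eq_starProjection_range.mp hQ
  exact (Submodule.starProjection_inj.mpr hker).trans hrange.symm

end Spectral

section Determinant

variable {G : Type*} [Group G] {r : ℕ} {P : L2Pow G r →L[ℂ] L2Pow G r}

theorem vonNeumannTrace_twoValued (P : L2Pow G r →L[ℂ] L2Pow G r) (α β : ℂ) :
    vonNeumannTrace (twoValued P α β) =
      α * vonNeumannTrace (1 - P) + β * vonNeumannTrace P := by
  simp only [vonNeumannTrace, twoValued, add_apply, smul_apply, inner_add_right,
    inner_smul_right, Finset.sum_add_distrib, ← Finset.mul_sum]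

theorem re_vonNeumannTrace_nonneg (hP : IsStarProjection P) : 0 ≤ (vonNeumannTrace P).re := by
  rw [vonNeumannTrace, Complex.re_sum]
  exact Finset.sum_nonneg fun i _ =>
    (ContinuousLinearMap.IsPositive.of_isStarProjection hP).re_inner_nonneg_right _

theorem spectralDensity_twoValued (hP : IsStarProjection P) {α β : ℝ} (hα : 0 < α) (hβ : 0 < β)
    (t : ℝ) :
    spectralDensity (twoValued P (α : ℂ) β) t =
      (if α ≤ t then (vonNeumannTrace (1 - P)).re else 0) +
        (if β ≤ t then (vonNeumannTrace P).re else 0) := by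
  rcases lt_or_ge t 0 with ht | ht
  · simp [spectralDensity, ht.not_ge, (ht.trans hα).not_ge, (ht.trans hβ).not_ge]
  · have htrace : spectralDensity (twoValued P (α : ℂ) β) t =
        (vonNeumannTrace (spectralProjection
          ((twoValued P (α : ℂ) β).adjoint ∘L twoValued P (α : ℂ) β) (t ^ 2))).re := if_pos ht
    rw [htrace, adjoint_comp_twoValued hP, spectralProjection_twoValued hP,
      vonNeumannTrace_twoValued]
    simp only [sq_le_sq₀ hα.le ht, sq_le_sq₀ hβ.le ht, ite_mul, one_mul, zero_mul,
      Complex.add_re, apply_ite Complex.re, Complex.zero_re]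

theorem stieltjes_measure_eq_smul_dirac_add {F : StieltjesFunction ℝ} {a b p q : ℝ}
    (hp : 0 ≤ p) (hq : 0 ≤ q)
    (hF : ∀ t, F t = (if a ≤ t then p else 0) + (if b ≤ t then q else 0)) :
    F.measure = ENNReal.ofReal p • Measure.dirac a + ENNReal.ofReal q • Measure.dirac b := by
  refine Measure.ext_of_Ioc _ _ fun c d hcd => ?_
  have hjump (x w : ℝ) : (if x ≤ d then w else 0) - (if x ≤ c then w else 0) =
      (Set.Ioc c d).indicator (fun _ => w) x := by
    grind [Set.indicator_apply]
  have hmass (x w : ℝ) : (ENNReal.ofReal w • Measure.dirac x) (Set.Ioc c d) =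
      ENNReal.ofReal ((Set.Ioc c d).indicator (fun _ => w) x) := by
    by_cases hx : x ∈ Set.Ioc c d <;> simp [hx, Measure.dirac_apply' _ measurableSet_Ioc]
  rw [StieltjesFunction.measure_Ioc, hF, hF, add_sub_add_comm, hjump, hjump, Measure.add_apply,
    hmass, hmass, ENNReal.ofReal_add]
  · exact Set.indicator_nonneg (fun _ _ => hp) a
  · exact Set.indicator_nonneg (fun _ _ => hq) b

theorem spectralStieltjes_measure_twoValued (hP : IsStarProjection P) {α β : ℝ} (hα : 0 < α)
    (hβ : 0 < β) :
    (spectralStieltjes (twoValued P (α : ℂ) β)).measure =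
      ENNReal.ofReal (vonNeumannTrace (1 - P)).re • Measure.dirac α +
        ENNReal.ofReal (vonNeumannTrace P).re • Measure.dirac β :=
  stieltjes_measure_eq_smul_dirac_add (re_vonNeumannTrace_nonneg hP.one_sub)
    (re_vonNeumannTrace_nonneg hP) (spectralDensity_twoValued hP hα hβ)

theorem fkDet_twoValued (hP : IsStarProjection P) {α β : ℝ} (hα : 0 < α) (hβ : 0 < β) :
    fkDet (twoValued P (α : ℂ) β) =
      α ^ (vonNeumannTrace (1 - P)).re * β ^ (vonNeumannTrace P).re := by
  have hint (x w : ℝ) : Integrable Real.log (ENNReal.ofReal w • Measure.dirac x) :=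
    (integrable_dirac (by simp)).smul_measure ENNReal.ofReal_ne_top
  have hrestrict : (spectralStieltjes (twoValued P (α : ℂ) β)).measure.restrict (Set.Ioi 0) =
      ENNReal.ofReal (vonNeumannTrace (1 - P)).re • Measure.dirac α +
        ENNReal.ofReal (vonNeumannTrace P).re • Measure.dirac β := by
    classical
    rw [spectralStieltjes_measure_twoValued hP hα hβ, Measure.restrict_add, Measure.restrict_smul,
      Measure.restrict_smul, restrict_dirac' measurableSet_Ioi, restrict_dirac' measurableSet_Ioi,
      if_pos (Set.mem_Ioi.mpr hα), if_pos (Set.mem_Ioi.mpr hβ)]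
  rw [fkDet, IntegrableOn, hrestrict, if_pos ((hint _ _).add_measure (hint _ _)),
    integral_add_measure (hint _ _) (hint _ _), integral_smul_measure, integral_smul_measure,
    integral_dirac, integral_dirac, ENNReal.toReal_ofReal (re_vonNeumannTrace_nonneg hP),
    ENNReal.toReal_ofReal (re_vonNeumannTrace_nonneg hP.one_sub), Real.exp_add,
    Real.rpow_def_of_pos hα, Real.rpow_def_of_pos hβ, smul_eq_mul, smul_eq_mul,
    mul_comm (Real.log α), mul_comm (Real.log β)]

end Determinant

section Average

variable {𝕜 A K : Type*} [Field 𝕜] [Ring A] [Algebra 𝕜 A] [Group K] [Fintype K]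

variable (𝕜) in
/-- The average of the operators of a finite group `K` acting through `U`, that is, the projection
onto the `K`-fixed vectors. -/
def average (U : K →* A) : A := (Fintype.card K : 𝕜)⁻¹ • ∑ k, U k

variable [CharZero 𝕜]

theorem one_add_sum_eq_twoValued_average (U : K →* A) :
    1 + ∑ k, U k = twoValued (average 𝕜 U) (1 : 𝕜) (1 + Fintype.card K) := by
  have hsum : (Fintype.card K : 𝕜) • average 𝕜 U = ∑ k, U k :=
    smul_inv_smul₀ (Nat.cast_ne_zero.mpr Fintype.card_ne_zero) _
  rw [← hsum, twoValued]
  module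

theorem isIdempotentElem_average (U : K →* A) : IsIdempotentElem (average 𝕜 U) := by
  have hfixed (k : K) : U k * ∑ l, U l = ∑ l, U l := by
    simp only [Finset.mul_sum, ← map_mul]
    exact Equiv.sum_comp (Equiv.mulLeft k) fun l => U l
  have hcard : (Fintype.card K : 𝕜) ≠ 0 := Nat.cast_ne_zero.mpr Fintype.card_ne_zero
  rw [IsIdempotentElem, average, smul_mul_assoc, mul_smul_comm, Finset.sum_mul]
  simp only [hfixed, Finset.sum_const, Finset.card_univ]
  rw [← Nat.cast_smul_eq_nsmul 𝕜, inv_smul_smul₀ hcard]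

theorem isStarProjection_average [StarRing 𝕜] [StarRing A] [StarModule 𝕜 A] {U : K →* A}
    (hU : ∀ k, star (U k) = U k⁻¹) : IsStarProjection (average 𝕜 U) where
  isIdempotentElem := isIdempotentElem_average U
  isSelfAdjoint := by
    rw [IsSelfAdjoint, average, star_smul, star_inv₀, star_natCast, star_sum]
    simp only [hU]
    exact congrArg _ (Equiv.sum_comp (Equiv.inv K) fun k => U k)

end Average

section RightRegular

variable {G : Type*} [Group G]

theorem rightTranslation_apply (h : G) (x : L2 G) (g : G) :
    rightTranslation h x g = x (g * h⁻¹) := rfl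

theorem inner_rightTranslation (h : G) (x y : L2 G) :
    inner ℂ (rightTranslation h x) y = inner ℂ x (rightTranslation h⁻¹ y) := by
  have hinv : rightTranslation h (rightTranslation h⁻¹ y) = y := by
    ext g
    simp only [rightTranslation_apply, inv_inv, inv_mul_cancel_right]
  rw [← (rightTranslation h).inner_map_map x, hinv]

theorem inner_basisVector {r : ℕ} (i : Fin r) (x : L2Pow G r) :
    inner ℂ (basisVector G i) x = x i 1 := by
  classical
  rw [PiLp.inner_apply, Finset.sum_eq_single i]
  · simp [basisVector, unitVector, lp.inner_single_left]
  · intro j _ hj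
    simp [basisVector, hj]
  · simp

theorem rightMul_add (a b : MonoidAlgebra ℤ G) : rightMul (a + b) = rightMul a + rightMul b := by
  classical
  simp only [rightMul, MonoidAlgebra.coeff_add]
  exact Finsupp.sum_add_index' (h := fun h (c : ℤ) =>
    (c : ℂ) • (rightTranslation h).toContinuousLinearMap) (by simp) (by simp [add_smul])

theorem rightMul_single (h : G) (c : ℤ) :
    rightMul (.single h c) = (c : ℂ) • (rightTranslation h).toContinuousLinearMap := by
  simp only [rightMul, MonoidAlgebra.coeff_single]
  exact Finsupp.sum_single_index (h := fun h (c : ℤ) =>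
    (c : ℂ) • (rightTranslation h).toContinuousLinearMap) (by simp)

theorem rightMul_zero : rightMul (0 : MonoidAlgebra ℤ G) = 0 := by
  simp [rightMul]

theorem rightMulMatrix_apply {r s : ℕ} (A : Matrix (Fin r) (Fin s) (MonoidAlgebra ℤ G))
    (x : L2Pow G r) (j : Fin s) : rightMulMatrix A x j = ∑ k, rightMul (A k j) (x k) := by
  simp [rightMulMatrix]

theorem rightMulMatrix_add {r s : ℕ} (A B : Matrix (Fin r) (Fin s) (MonoidAlgebra ℤ G)) :
    rightMulMatrix (A + B) = rightMulMatrix A + rightMulMatrix B := by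
  ext1 x
  ext1 j
  simp [rightMulMatrix_apply, rightMul_add, Finset.sum_add_distrib]

theorem rightMulMatrix_sum {r s : ℕ} {ι : Type*} (t : Finset ι)
    (A : ι → Matrix (Fin r) (Fin s) (MonoidAlgebra ℤ G)) :
    rightMulMatrix (∑ i ∈ t, A i) = ∑ i ∈ t, rightMulMatrix (A i) :=
  map_sum (AddMonoidHom.mk' rightMulMatrix rightMulMatrix_add) A t

theorem rightMulMatrix_scalar_apply {r : ℕ} (a : MonoidAlgebra ℤ G) (x : L2Pow G r) (j : Fin r) :
    rightMulMatrix (Matrix.scalar (Fin r) a) x j = rightMul a (x j) := by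
  rw [rightMulMatrix_apply, Finset.sum_eq_single j]
  · simp
  · intro k _ hk
    simp [hk, rightMul_zero]
  · simp

variable (G) in
/-- The right regular representation of `G` on `L²(G)^r`. An element `g` acts by `x ↦ x · g⁻¹`, as
`rightMulMatrix` multiplies from the right and thus reverses products. -/
noncomputable def rightRegular (r : ℕ) : G →* (L2Pow G r →L[ℂ] L2Pow G r) where
  toFun g := rightMulMatrix (Matrix.scalar (Fin r) (.single g⁻¹ 1))
  map_one' := by
    ext1 x
    ext j g
    rw [rightMulMatrix_scalar_apply]
    simp [rightMul_single, rightTranslation_apply]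
  map_mul' g h := by
    ext1 x
    ext j k
    rw [mul_apply_eq_comp, rightMulMatrix_scalar_apply, rightMulMatrix_scalar_apply,
      rightMulMatrix_scalar_apply]
    simp [rightMul_single, rightTranslation_apply, mul_assoc]

theorem rightRegular_apply {r : ℕ} (g : G) (x : L2Pow G r) (j : Fin r) :
    rightRegular G r g x j = rightTranslation g⁻¹ (x j) := by
  change rightMulMatrix _ x j = _
  simp [rightMulMatrix_scalar_apply, rightMul_single, -Matrix.scalar_apply]

theorem star_rightRegular {r : ℕ} (g : G) : star (rightRegular G r g) = rightRegular G r g⁻¹ := by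
  rw [ContinuousLinearMap.star_eq_adjoint, eq_comm, ContinuousLinearMap.eq_adjoint_iff]
  intro x y
  simp only [PiLp.inner_apply, rightRegular_apply, inner_rightTranslation, inv_inv]

theorem vonNeumannTrace_rightRegular [DecidableEq G] (r : ℕ) (g : G) :
    vonNeumannTrace (rightRegular G r g) = if g = 1 then (r : ℂ) else 0 := by
  have hentry (i : Fin r) : inner ℂ (basisVector G i) (rightRegular G r g (basisVector G i)) =
      if g = 1 then (1 : ℂ) else 0 := by
    rw [inner_basisVector, rightRegular_apply, rightTranslation_apply]
    simp [basisVector, unitVector, Pi.single_apply]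
  simp [vonNeumannTrace, hentry]

theorem vonNeumannTrace_sum {r : ℕ} {ι : Type*} (t : Finset ι)
    (f : ι → L2Pow G r →L[ℂ] L2Pow G r) :
    vonNeumannTrace (∑ i ∈ t, f i) = ∑ i ∈ t, vonNeumannTrace (f i) := by
  simp only [vonNeumannTrace, sum_apply, inner_sum]
  exact Finset.sum_comm

theorem vonNeumannTrace_average_rightRegular (r : ℕ) (K : Subgroup G) [Fintype K] :
    vonNeumannTrace (average ℂ ((rightRegular G r).comp K.subtype)) = r / Fintype.card K := by
  classical
  have hsmul (c : ℂ) (f : L2Pow G r →L[ℂ] L2Pow G r) :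
      vonNeumannTrace (c • f) = c * vonNeumannTrace f := by
    simp [vonNeumannTrace, Finset.mul_sum]
  rw [average, hsmul, vonNeumannTrace_sum]
  simp [vonNeumannTrace_rightRegular, div_eq_inv_mul]

theorem rightMulMatrix_scalar_one_add_sum (r : ℕ) (K : Subgroup G) [Fintype K] :
    rightMulMatrix (Matrix.scalar (Fin r) (1 + ∑ k : K, MonoidAlgebra.single (k : G) (1 : ℤ))) =
      twoValued (average ℂ ((rightRegular G r).comp K.subtype)) (1 : ℂ) (1 + Fintype.card K) := by
  have hone : rightMulMatrix (Matrix.scalar (Fin r) (1 : MonoidAlgebra ℤ G)) = 1 := by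
    simpa [rightRegular, MonoidAlgebra.one_def] using (rightRegular G r).map_one
  have hsingle (k : K) : rightMulMatrix (Matrix.scalar (Fin r) (.single (k : G) 1)) =
      rightRegular G r (k⁻¹ : K) := by
    simp [rightRegular]
  rw [← one_add_sum_eq_twoValued_average, map_add, map_sum, rightMulMatrix_add, rightMulMatrix_sum,
    hone]
  simp only [hsingle]
  exact congrArg (1 + ·) (Equiv.sum_comp (Equiv.inv K) fun k => rightRegular G r k)

theorem isStarProjection_average_rightRegular (r : ℕ) (K : Subgroup G) [Fintype K] :
    IsStarProjection (average ℂ ((rightRegular G r).comp K.subtype)) :=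
  isStarProjection_average fun k => by simp [star_rightRegular]

end RightRegular

section Constants

variable {G : Type*} [Group G]

theorem isWeakIso_rightMulMatrix_scalar_one_add_sum (r : ℕ) (K : Subgroup G) [Fintype K] :
    IsWeakIso (rightMulMatrix
      (Matrix.scalar (Fin r) (1 + ∑ k : K, MonoidAlgebra.single (k : G) (1 : ℤ)))) := by
  have hcard : (1 + Fintype.card K : ℂ) ≠ 0 := by norm_cast; omega
  have hunit := isUnit_twoValued (isIdempotentElem_average (𝕜 := ℂ)
    ((rightRegular G r).comp K.subtype)) one_ne_zero hcard
  rw [← rightMulMatrix_scalar_one_add_sum, ContinuousLinearMap.isUnit_iff_bijective] at hunit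
  exact ⟨hunit.injective, hunit.surjective.denseRange⟩

theorem fkDet_rightMulMatrix_scalar_one_add_sum (r : ℕ) (K : Subgroup G) [Fintype K] :
    fkDet (rightMulMatrix
      (Matrix.scalar (Fin r) (1 + ∑ k : K, MonoidAlgebra.single (k : G) (1 : ℤ)))) =
      (1 + Fintype.card K : ℝ) ^ (r / Fintype.card K : ℝ) := by
  have hdet := fkDet_twoValued (isStarProjection_average_rightRegular r K) zero_lt_one
    (by positivity : (0 : ℝ) < 1 + Fintype.card K)
  rw [vonNeumannTrace_average_rightRegular, Complex.div_natCast_re, Complex.natCast_re,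
    Real.one_rpow, one_mul] at hdet
  rw [rightMulMatrix_scalar_one_add_sum, ← hdet]
  norm_cast

theorem tendsto_one_add_rpow_one_div :
    Filter.Tendsto (fun x : ℝ => (1 + x) ^ (1 / x)) Filter.atTop (nhds 1) := by
  have h := (tendsto_rpow_div_mul_add 1 1 (-1) one_ne_zero.symm).comp
    (Filter.tendsto_atTop_add_const_left _ 1 Filter.tendsto_id)
  simpa [Function.comp_def] using h

theorem HasArbitrarilyLargeFiniteSubgroups.exists_fkDet_lt
    (hG : HasArbitrarilyLargeFiniteSubgroups G) {b : ℝ} (hb : 1 < b) :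
    ∃ A : Matrix (Fin 1) (Fin 1) (MonoidAlgebra ℤ G), IsWeakIso (rightMulMatrix A) ∧
      1 < fkDet (rightMulMatrix A) ∧ fkDet (rightMulMatrix A) < b := by
  have hlim := tendsto_one_add_rpow_one_div.comp (tendsto_natCast_atTop_atTop (R := ℝ))
  obtain ⟨N, hN⟩ := Filter.eventually_atTop.mp (hlim.eventually_lt_const hb)
  obtain ⟨K, hK, hNK⟩ := hG N
  have := Fintype.ofFinite K
  rw [Nat.card_eq_fintype_card] at hNK
  have hcard : (0 : ℝ) < Fintype.card K := Nat.cast_pos.mpr Fintype.card_pos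
  refine ⟨_, isWeakIso_rightMulMatrix_scalar_one_add_sum 1 K, ?_, ?_⟩ <;>
    rw [fkDet_rightMulMatrix_scalar_one_add_sum, Nat.cast_one]
  · exact Real.one_lt_rpow (lt_add_of_pos_right 1 hcard) (one_div_pos.mpr hcard)
  · exact hN _ hNK

theorem sInf_eq_one_of_forall_exists_lt {S : Set ℝ} (hS : ∀ d ∈ S, 1 < d)
    (hlt : ∀ b, 1 < b → ∃ d ∈ S, d < b) : sInf S = 1 := by
  obtain ⟨d, hd, -⟩ := hlt 2 one_lt_two
  exact csInf_eq_of_forall_ge_of_forall_gt_exists_lt ⟨d, hd⟩ (fun d hd => (hS d hd).le) hlt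

theorem HasArbitrarilyLargeFiniteSubgroups.lehmer_constants_eq_one
    (hG : HasArbitrarilyLargeFiniteSubgroups G) :
    lehmer G = 1 ∧ lehmerW G = 1 ∧ lehmerOne G = 1 ∧ lehmerWOne G = 1 := by
  refine ⟨?_, ?_, ?_, ?_⟩ <;>
    refine sInf_eq_one_of_forall_exists_lt (fun d hd => hd.1) fun b hb => ?_ <;>
    obtain ⟨A, hA, hone_lt, hlt⟩ := hG.exists_fkDet_lt hb
  · exact ⟨_, ⟨hone_lt, 1, 1, le_rfl, le_rfl, A, rfl⟩, hlt⟩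
  · exact ⟨_, ⟨hone_lt, 1, le_rfl, A, hA, rfl⟩, hlt⟩
  · exact ⟨_, ⟨hone_lt, A, rfl⟩, hlt⟩
  · exact ⟨_, ⟨hone_lt, A, hA, rfl⟩, hlt⟩

end Constants

end Lehmer

theorem mainTheorem10 :
    -- the lamplighter group is finitely generated
    Group.FG Lehmer.Lamplighter ∧
    -- it contains finite subgroups of arbitrarily large order
    (∀ n : ℕ, ∃ K : Subgroup Lehmer.Lamplighter, Finite K ∧ n ≤ Nat.card K) ∧
    -- all its four Lehmer constants are one
    (Lehmer.lehmer Lehmer.Lamplighter = 1 ∧ Lehmer.lehmerW Lehmer.Lamplighter = 1 ∧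
      Lehmer.lehmerOne Lehmer.Lamplighter = 1 ∧ Lehmer.lehmerWOne Lehmer.Lamplighter = 1) ∧
    -- it embeds into a finitely presented group all of whose Lehmer constants are one
    ∃ (G : Type) (_ : Group G), Group.IsFinitelyPresented G ∧
      (∃ i : Lehmer.Lamplighter →* G, Function.Injective i) ∧
      Lehmer.lehmer G = 1 ∧ Lehmer.lehmerW G = 1 ∧
      Lehmer.lehmerOne G = 1 ∧ Lehmer.lehmerWOne G = 1 := by
  have hL := Lehmer.HasArbitrarilyLargeFiniteSubgroups.lamplighter
  have hembedding := Lehmer.BaumslagGroup.ofLamplighter_injective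
  exact ⟨Lehmer.Lamplighter.fg, hL, hL.lehmer_constants_eq_one, Lehmer.BaumslagGroup,
    inferInstance, Lehmer.BaumslagGroup.isFinitelyPresented, ⟨_, hembedding⟩,
    (hL.of_injective hembedding).lehmer_constants_eq_one⟩
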